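/- Let $\Phi$ be a unital qubit channel, i.e. a completely positive, trace-preserving linear map on $2\times 2$ complex matrices with $\Phi(I)=I$. All logarithms are to base $2$; $S(\rho)=-\operatorname{Tr}(\rho\log_2\rho)$ and $h(q)=-q\log_2 q-(1-q)\log_2(1-q)$. A state is a positive semidefinite $2\times2$ matrix of trace one. Let $$\chi(\Phi)=\sup_{p\in[0,1],\ \rho,\rho'\text{ states}}\Big(S\big(\Phi(p\rho+(1-p)\rho')\big)-p\,S(\Phi(\rho))-(1-p)\,S(\Phi(\rho'))\Big)$$ (the single-letter formula for the classical capacity of $\Phi$), and let $M_\Phi=\sup_{\rho}\|\Phi(\rho)\|$, the supremum over states $\rho$ of the operator norm. Both suprema are finite and $\tfrac12\le M_\Phi\le 1$. Let $\mathcal R_\Phi$ be the set of states $\rho$ with $\|\Phi(\rho)\|=M_\Phi$, and for $\rho\in\mathcal R_\Phi$ let $\Gamma_{\Phi,\rho}$ be the set of states $\tau$ with $\operatorname{Tr}(\Phi(\rho)\tau)=M_\Phi$. Then $\mathcal R_\Phi\neq\emptyset$, and for every $\rho\in\mathcal R_\Phi$ the set $\Gamma_{\Phi,\rho}$ contains an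 orthogonal projector. Let $\rho^*\in\mathcal R_\Phi$ and $\tau^*\in\Gamma_{\Phi,\rho^*}$ be arbitrary. Encode the bit $0$ as $\rho^*$ and the bit $1$ as $I-\rho^*$, and measure each channel output with $\{P_0=I-\tau^*,\ P_1=\tau^*\}$. Then $I-\rho^*$ is a state, $\{P_0,P_1\}$ is a POVM, and it consists of orthogonal projectors if $M_\Phi\ne\tfrac12$. Moreover: 1. The induced classical channel $p(y|x)$ of one use of $\Phi$ is the binary symmetric channel $\mathrm{BSC}(M_\Phi)$ with flip probability $M_\Phi$; used qubit by qubit over $\Phi^{\otimes n}$, the scheme induces $n$ independent uses of $\mathrm{BSC}(M_\Phi)$, for every $n$. 2. The Shannon capacity $\max_{p(x)}I(X;Y)$ of the induced channel is $1-h(M_\Phi)$, and $1-h(M_\Phi)=\chi(\Phi)$. 3. Consequently the scheme achieves $\chi(\Phi)$: there are sequences of classical block codes of length $n=0,1,2,\dots$ whose rate tends to the Shannon capacity of $\mathrm{BSC}(M_\Phi)$ and whose maximal error probability over $\mathrm{BSC}(M_\Phi)$ tends to $0$; and every such sequence, combined with the product encoding and product measurement above over $\Phi^{\otimes n}$, has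 rate tending to $\chi(\Phi)$ and maximal error probability tending to $0$. -/

import Mathlib

open scoped ComplexOrder Matrix

namespace UnitalQubit

/-! ### Qubit states and unital qubit channels -/

/-- Operators on the Hilbert space of one qubit. -/
abbrev Op : Type := Matrix (Fin 2) (Fin 2) ℂ

/-- Density operators: positive semidefinite with unit trace. -/
def IsState (ρ : Op) : Prop := ρ.PosSemidef ∧ ρ.trace = 1

/-- The ampliation `Φ ⊗ id` acting on operators on the tensor product of the qubit with a
`k`-dimensional reference system: `Φ` is applied to each of the `k × k` qubit blocks. -/
def ampliation (Φ : Op →ₗ[ℂ] Op) (k : ℕ) (X : Matrix (Fin 2 × Fin k) (Fin 2 × Fin k) ℂ) :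
    Matrix (Fin 2 × Fin k) (Fin 2 × Fin k) ℂ :=
  Matrix.of fun a b => Φ (Matrix.of fun i j => X (i, a.2) (j, b.2)) a.1 b.1

/-- Complete positivity: all ampliations preserve positive semidefiniteness. -/
def IsCompletelyPositive (Φ : Op →ₗ[ℂ] Op) : Prop :=
  ∀ (k : ℕ) (X : Matrix (Fin 2 × Fin k) (Fin 2 × Fin k) ℂ),
    X.PosSemidef → (ampliation Φ k X).PosSemidef

/-- A unital qubit channel: completely positive, trace preserving, and `Φ(I) = I`. -/
structure IsUnitalQubitChannel (Φ : Op →ₗ[ℂ] Op) : Prop where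
  completely_positive : IsCompletelyPositive Φ
  trace_preserving : ∀ A : Op, (Φ A).trace = A.trace
  unital : Φ 1 = 1

/-- The operator norm with respect to the Euclidean norm on `ℂ²`. -/
noncomputable def opNorm (A : Op) : ℝ := ‖Matrix.toEuclideanCLM (n := Fin 2) (𝕜 := ℂ) A‖

/-- The operator norms of all channel outputs. -/
def outputNorms (Φ : Op →ₗ[ℂ] Op) : Set ℝ := {x | ∃ ρ : Op, IsState ρ ∧ x = opNorm (Φ ρ)}

/-- The maximal output norm `M_Φ = sup_ρ ‖Φ(ρ)‖`. -/
noncomputable def maxOutputNorm (Φ : Op →ₗ[ℂ] Op) : ℝ := sSup (outputNorms Φ)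

/-- The states that attain the supremum `M_Φ`. -/
def normMaximizers (Φ : Op →ₗ[ℂ] Op) : Set Op :=
  {ρ | IsState ρ ∧ opNorm (Φ ρ) = maxOutputNorm Φ}

/-- The states `τ` with `Tr(Φ(ρ) τ) = M_Φ`. -/
def detectors (Φ : Op →ₗ[ℂ] Op) (ρ : Op) : Set Op :=
  {τ | IsState τ ∧ (Φ ρ * τ).trace = (maxOutputNorm Φ : ℂ)}

/-! ### Entropies (in bits) and the Holevo information -/

open Classical in
/-- The von Neumann entropy `-Tr(ρ log₂ ρ)`, computed from the eigenvalues of the Hermitian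
operator `ρ` (and set to `0` for other operators). -/
noncomputable def vonNeumannEntropy (ρ : Op) : ℝ :=
  if h : ρ.IsHermitian then -∑ i, h.eigenvalues i * Real.logb 2 (h.eigenvalues i) else 0

/-- The values `S(Φ(pρ + (1-p)ρ')) - p S(Φ(ρ)) - (1-p) S(Φ(ρ'))` over all probabilities `p`
and states `ρ`, `ρ'`. -/
def holevoValues (Φ : Op →ₗ[ℂ] Op) : Set ℝ :=
  {x | ∃ (p : ℝ) (ρ ρ' : Op), 0 ≤ p ∧ p ≤ 1 ∧ IsState ρ ∧ IsState ρ' ∧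
    x = vonNeumannEntropy (Φ (p • ρ + (1 - p) • ρ'))
      - p * vonNeumannEntropy (Φ ρ) - (1 - p) * vonNeumannEntropy (Φ ρ')}

/-- The Holevo information `χ(Φ)` of a unital qubit channel. -/
noncomputable def holevoInformation (Φ : Op →ₗ[ℂ] Op) : ℝ := sSup (holevoValues Φ)

/-- The binary entropy function `h`, in bits. -/
noncomputable def binaryEntropy (q : ℝ) : ℝ :=
  -(q * Real.logb 2 q + (1 - q) * Real.logb 2 (1 - q))

/-- The Shannon entropy, in bits, of a distribution on a finite set. -/
noncomputable def shannonEntropy {X : Type*} [Fintype X] (p : X → ℝ) : ℝ :=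
  -∑ x, p x * Real.logb 2 (p x)

/-! ### Classical channels

A classical channel is given by its transition probabilities: `W x y` is the probability of the
output `y` when the input is `x`. -/

/-- The mutual information `H(X) + H(Y) - H(X,Y)` for the input distribution `p`. -/
noncomputable def mutualInformation {X Y : Type*} [Fintype X] [Fintype Y]
    (W : X → Y → ℝ) (p : X → ℝ) : ℝ :=
  shannonEntropy p + shannonEntropy (fun y => ∑ x, p x * W x y)
    - shannonEntropy (fun z : X × Y => p z.1 * W z.1 z.2)

/-- The mutual informations for all input distributions. -/
def mutualInformations {X Y : Type*} [Fintype X] [Fintype Y] (W : X → Y → ℝ) : Set ℝ :=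
  mutualInformation W '' stdSimplex ℝ X

/-- The Shannon capacity of a classical channel. -/
noncomputable def shannonCapacity {X Y : Type*} [Fintype X] [Fintype Y] (W : X → Y → ℝ) : ℝ :=
  sSup (mutualInformations W)

/-- The binary symmetric channel with flip probability `q`. -/
def bsc (q : ℝ) (x y : Fin 2) : ℝ := if x = y then 1 - q else q

/-- `n` independent uses of a classical binary channel. -/
def memoryless (W : Fin 2 → Fin 2 → ℝ) (n : ℕ) (x y : Fin n → Fin 2) : ℝ := ∏ i, W (x i) (y i)

/-- A classical block code of length `n` over a binary alphabet, with its decoder. -/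
structure BlockCode (n : ℕ) where
  /-- number of messages -/
  size : ℕ
  encode : Fin size → (Fin n → Fin 2)
  decode : (Fin n → Fin 2) → Fin size

/-- The probability that message `m` is decoded incorrectly when codewords of length `n` are
received with the transition probabilities `V`. -/
def errorProb {n : ℕ} (V : (Fin n → Fin 2) → (Fin n → Fin 2) → ℝ) (c : BlockCode n)
    (m : Fin c.size) : ℝ :=
  ∑ y, if c.decode y = m then 0 else V (c.encode m) y

/-- The sequence of codes `c n` of length `n` has rate tending to `R` (in bits per channel use)
and maximal error probability tending to `0`, when blocks of length `n` are received with the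
transition probabilities `V n`. -/
def AchievesRate (V : (n : ℕ) → (Fin n → Fin 2) → (Fin n → Fin 2) → ℝ)
    (c : (n : ℕ) → BlockCode n) (R : ℝ) : Prop :=
  Filter.Tendsto (fun n : ℕ => Real.logb 2 ((c n).size : ℝ) / (n : ℝ)) Filter.atTop (nhds R) ∧
  Filter.Tendsto (fun n : ℕ => ⨆ m, errorProb (V n) (c n) m) Filter.atTop (nhds 0)

/-! ### The product encoding and decoding scheme -/

/-- Bit `0` is encoded as `ρ` and bit `1` as `I - ρ`. -/
def encoder (ρ : Op) : Fin 2 → Op := ![ρ, 1 - ρ]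

/-- The measurement `{P₀ = I - τ, P₁ = τ}`. -/
def measurement (τ : Op) : Fin 2 → Op := ![1 - τ, τ]

/-- A measurement with outcomes in `Y`: positive operators that sum to the identity. -/
def IsPOVM {Y : Type*} [Fintype Y] (P : Y → Op) : Prop :=
  (∀ y, (P y).PosSemidef) ∧ ∑ y, P y = 1

/-- The induced classical channel for one use of `Φ`, with transition probabilities
`p(y|x) = Tr(P_y Φ(E_x))`. -/
def inducedChannel (Φ : Op →ₗ[ℂ] Op) (E P : Fin 2 → Op) (x y : Fin 2) : ℝ :=
  (P y * Φ (E x)).trace.re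

/-- The product operator `A₁ ⊗ ⋯ ⊗ Aₙ` on `n` qubits. -/
def productOp {n : ℕ} (A : Fin n → Op) : Matrix (Fin n → Fin 2) (Fin n → Fin 2) ℂ :=
  Matrix.of fun a b => ∏ i, A i (a i) (b i)

/-- The `n`-fold tensor power `Φ ⊗ ⋯ ⊗ Φ`: the linear map that sends each tensor product of
matrix units `⊗ᵢ |aᵢ⟩⟨bᵢ|` to `⊗ᵢ Φ(|aᵢ⟩⟨bᵢ|)`. -/
def tensorPower (Φ : Op →ₗ[ℂ] Op) (n : ℕ) (X : Matrix (Fin n → Fin 2) (Fin n → Fin 2) ℂ) :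
    Matrix (Fin n → Fin 2) (Fin n → Fin 2) ℂ :=
  ∑ a, ∑ b, X a b • productOp fun i => Φ (Matrix.single (a i) (b i) 1)

/-- The probability of observing the string `y` when the string `x` is encoded qubit by qubit
with `E`, sent through `n` independent uses of `Φ`, and measured qubit by qubit with `P`. -/
def inducedBlockChannel (Φ : Op →ₗ[ℂ] Op) (E P : Fin 2 → Op) (n : ℕ)
    (x y : Fin n → Fin 2) : ℝ :=
  (productOp (fun i => P (y i)) * tensorPower Φ n (productOp fun i => E (x i))).trace.re

end UnitalQubit

namespace UnitalQubit

/-! A qubit state has spectrum `{μ, 1 - μ}` with `μ` its norm, so its entropy is `h(μ)`, decreasing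
in `μ ∈ [1/2, 1]`. Hence every output has entropy at least `h(M_Φ)`, every average output has
entropy at most `1`, and `χ(Φ) ≤ 1 - h(M_Φ)`. The equiprobable ensemble `{ρ*, I - ρ*}` is tight: its
average `I/2` is fixed by `Φ`, and `Φ(I - ρ*) = I - Φ(ρ*)` has the spectrum of `Φ(ρ*)`
(`isGreatest_holevoValues`). Compactness of the state space provides `ρ*`.

Unitality also gives `Tr(τ* Φ(I - ρ*)) = 1 - M_Φ`, so the measurement sees a binary symmetric
channel; products of operators turn `Φ^{⊗n}` into its memoryless extension. Uniform input shows that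
its capacity is again `1 - h(M_Φ)`.

Existence of good codes is Shannon's theorem by Feinstein's greedy argument
(`exists_decoding_sets`), with Chebyshev's inequality controlling atypical noise. Since block
channels agree exactly, every classical code transfers unchanged. -/

/-! ### Binary entropy -/

theorem binaryEntropy_eq (q : ℝ) : binaryEntropy q = Real.binEntropy q / Real.log 2 := by
  simp only [binaryEntropy, Real.logb, Real.binEntropy, Real.log_inv]
  ring

theorem binaryEntropy_half : binaryEntropy (1 / 2) = 1 := by
  rw [binaryEntropy_eq, one_div, Real.binEntropy_two_inv, div_self (Real.log_pos one_lt_two).ne']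

theorem binaryEntropy_le_one (q : ℝ) : binaryEntropy q ≤ 1 := by
  rw [binaryEntropy_eq, div_le_one (Real.log_pos one_lt_two)]
  exact Real.binEntropy_le_log_two

theorem binaryEntropy_anti {p q : ℝ} (h0 : 1 / 2 ≤ p) (hpq : p ≤ q) (h1 : q ≤ 1) :
    binaryEntropy q ≤ binaryEntropy p := by
  rw [binaryEntropy_eq, binaryEntropy_eq]
  have : (2 : ℝ)⁻¹ ≤ p := by linarith
  exact div_le_div_of_nonneg_right (Real.binEntropy_strictAntiOn.antitoneOn
    ⟨this, hpq.trans h1⟩ ⟨this.trans hpq, h1⟩ hpq) (Real.log_pos one_lt_two).le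

/-! ### Qubit states: complements, spectrum and entropy -/

theorem trace_one_sub_mul {A B : Op} : ((1 - A) * B).trace = B.trace - (A * B).trace := by
  rw [sub_mul, one_mul, Matrix.trace_sub]

theorem det_one_sub {A : Op} (h : A.trace = 1) : (1 - A).det = A.det := by
  rw [Matrix.trace_fin_two] at h
  simp only [Matrix.det_fin_two, Matrix.sub_apply, Matrix.one_apply]
  simp
  linear_combination -h

/-- For trace one, `1 - A` is the adjugate of `A`, and a `2 × 2` adjugate is the transpose
conjugated by a rotation. This form makes positivity of `1 - A` evident. -/
theorem one_sub_eq {A : Op} (h : A.trace = 1) :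
    1 - A = (!![0, 1; -1, 0] : Op)ᴴ * Aᵀ * !![0, 1; -1, 0] := by
  rw [Matrix.trace_fin_two] at h
  ext i j
  fin_cases i <;> fin_cases j <;>
    simp [Matrix.mul_apply, Fin.sum_univ_two, Matrix.conjTranspose_apply] <;>
    linear_combination -h

theorem IsState.one_sub {ρ : Op} (h : IsState ρ) : IsState (1 - ρ) := by
  refine ⟨?_, ?_⟩
  · rw [one_sub_eq h.2]
    exact h.1.transpose.conjTranspose_mul_mul_same _
  · rw [Matrix.trace_sub, h.2]; simp; norm_num

theorem IsState.mix {ρ σ : Op} (hρ : IsState ρ) (hσ : IsState σ) {p : ℝ} (h0 : 0 ≤ p)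
    (h1 : p ≤ 1) : IsState (p • ρ + (1 - p) • σ) := by
  refine ⟨(hρ.1.smul h0).add (hσ.1.smul (sub_nonneg.2 h1)), ?_⟩
  simp [Matrix.trace_add, Matrix.trace_smul, hρ.2, hσ.2]

theorem IsUnitalQubitChannel.map_isState {Φ : Op →ₗ[ℂ] Op} (hΦ : IsUnitalQubitChannel Φ)
    {ρ : Op} (h : IsState ρ) : IsState (Φ ρ) := by
  refine ⟨?_, (hΦ.trace_preserving ρ).trans h.2⟩
  -- A one-dimensional reference system reduces complete positivity to positivity; the two
  -- `submatrix` maps identify `Fin 2 × Fin 1` with `Fin 2`.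
  have := (hΦ.completely_positive 1 _ (h.1.submatrix Prod.fst)).submatrix (fun i => (i, 0))
  exact this

theorem IsState.sum_eigenvalues {A : Op} (h : IsState A) :
    h.1.isHermitian.eigenvalues 0 + h.1.isHermitian.eigenvalues 1 = 1 := by
  have := h.2.symm.trans h.1.isHermitian.trace_eq_sum_eigenvalues
  rw [Fin.sum_univ_two] at this
  exact Complex.ofReal_injective (by simpa using this.symm)

theorem opNorm_eq_norm_eigenvalues {A : Op} (h : A.IsHermitian) :
    opNorm A = ‖h.eigenvalues‖ := by
  open scoped Matrix.Norms.L2Operator in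
  change ‖A‖ = _
  conv_lhs => rw [h.spectral_theorem]
  rw [Unitary.conjStarAlgAut_apply, ← Unitary.coe_star,
    CStarRing.norm_mul_coe_unitary, CStarRing.norm_coe_unitary_mul, Matrix.l2_opNorm_diagonal]
  simp [Pi.norm_def, nnnorm]

/-- The eigenvalues of a state are its norm and the complement of its norm. -/
theorem IsState.exists_eigenvalue {A : Op} (h : IsState A) :
    ∃ i j : Fin 2, i ≠ j ∧ h.1.isHermitian.eigenvalues i = opNorm A ∧
      h.1.isHermitian.eigenvalues j = 1 - opNorm A ∧ 1 / 2 ≤ opNorm A ∧ opNorm A ≤ 1 := by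
  have hs := h.sum_eigenvalues
  have h0 := h.1.eigenvalues_nonneg 0
  have h1 := h.1.eigenvalues_nonneg 1
  have hn : opNorm A = max (h.1.isHermitian.eigenvalues 0) (h.1.isHermitian.eigenvalues 1) := by
    rw [opNorm_eq_norm_eigenvalues h.1.isHermitian]
    apply le_antisymm
    · rw [pi_norm_le_iff_of_nonneg (le_max_of_le_left h0)]
      intro i
      fin_cases i
      · simp [abs_of_nonneg h0]
      · simp [abs_of_nonneg h1]
    · exact max_le ((le_abs_self _).trans (norm_le_pi_norm h.1.isHermitian.eigenvalues 0))
        ((le_abs_self _).trans (norm_le_pi_norm h.1.isHermitian.eigenvalues 1))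
  rcases le_total (h.1.isHermitian.eigenvalues 0) (h.1.isHermitian.eigenvalues 1) with hl | hl
  · rw [max_eq_right hl] at hn
    exact ⟨1, 0, by decide, hn.symm, by linarith, by linarith, by linarith⟩
  · rw [max_eq_left hl] at hn
    exact ⟨0, 1, by decide, hn.symm, by linarith, by linarith, by linarith⟩

theorem sum_fin_two_of_ne {M : Type*} [AddCommMonoid M] (f : Fin 2 → M) {i j : Fin 2} (h : i ≠ j) :
    ∑ k, f k = f i + f j := by
  rw [Fin.sum_univ_two]
  fin_cases i <;> fin_cases j <;> first | exact absurd rfl h | simp [add_comm]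

theorem IsState.half_le_opNorm {A : Op} (h : IsState A) : 1 / 2 ≤ opNorm A := by
  obtain ⟨i, j, -, -, -, h1, -⟩ := h.exists_eigenvalue
  exact h1

theorem IsState.opNorm_le_one {A : Op} (h : IsState A) : opNorm A ≤ 1 := by
  obtain ⟨i, j, -, -, -, -, h1⟩ := h.exists_eigenvalue
  exact h1

theorem IsState.vonNeumannEntropy_eq {A : Op} (h : IsState A) :
    vonNeumannEntropy A = binaryEntropy (opNorm A) := by
  obtain ⟨i, j, hij, hi, hj, -, -⟩ := h.exists_eigenvalue
  rw [vonNeumannEntropy, dif_pos h.1.isHermitian, sum_fin_two_of_ne _ hij, hi, hj, binaryEntropy]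

theorem IsState.det_eq {A : Op} (h : IsState A) :
    A.det = (opNorm A * (1 - opNorm A) : ℝ) := by
  obtain ⟨i, j, hij, hi, hj, -, -⟩ := h.exists_eigenvalue
  rw [h.1.isHermitian.det_eq_prod_eigenvalues, ← hj, ← hi]
  rw [Fin.prod_univ_two]
  push_cast
  fin_cases i <;> fin_cases j <;> first | exact absurd rfl hij | simp [mul_comm]

theorem IsState.opNorm_one_sub {A : Op} (h : IsState A) : opNorm (1 - A) = opNorm A := by
  have h1 := h.one_sub.det_eq
  rw [det_one_sub h.2, h.det_eq, Complex.ofReal_inj] at h1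
  have h2 := h.half_le_opNorm
  have h3 := h.one_sub.half_le_opNorm
  -- `x * (1 - x)` is injective on `[1/2, ∞)`, so equal determinants force equal norms.
  nlinarith

theorem IsState.vonNeumannEntropy_one_sub {A : Op} (h : IsState A) :
    vonNeumannEntropy (1 - A) = vonNeumannEntropy A := by
  rw [h.vonNeumannEntropy_eq, h.one_sub.vonNeumannEntropy_eq, h.opNorm_one_sub]

theorem isState_half : IsState ((1 / 2 : ℝ) • (1 : Op)) := by
  refine ⟨Matrix.PosSemidef.one.smul (by norm_num), ?_⟩
  simp [Matrix.trace_smul]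

theorem vonNeumannEntropy_half : vonNeumannEntropy ((1 / 2 : ℝ) • (1 : Op)) = 1 := by
  have h := isState_half.det_eq
  have h2 := isState_half.half_le_opNorm
  rw [isState_half.vonNeumannEntropy_eq]
  have h3 : opNorm ((1 / 2 : ℝ) • (1 : Op)) = 1 / 2 := by
    have h4 : ((1 / 2 : ℝ) • (1 : Op)).det = (1 / 4 : ℝ) := by
      simp; norm_num
    rw [h4, Complex.ofReal_inj] at h
    nlinarith
  rw [h3, binaryEntropy_half]

/-! ### Optimal detection of a state -/

/-- In an eigenbasis of `A`, the trace of `A * τ` only involves the diagonal of `τ`. -/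
theorem trace_mul_eq_sum_eigenvalues {A : Op} (h : A.IsHermitian) (τ : Op) :
    (A * τ).trace = ∑ i, h.eigenvalues i *
      ((h.eigenvectorUnitary : Op)ᴴ * τ * (h.eigenvectorUnitary : Op)) i i := by
  conv_lhs => rw [h.spectral_theorem, Unitary.conjStarAlgAut_apply]
  rw [mul_assoc, mul_assoc, Matrix.trace_mul_comm, mul_assoc, Matrix.trace]
  simp [Matrix.diagonal_mul, Matrix.star_eq_conjTranspose, mul_assoc]

/-- Cayley–Hamilton: `τ² = (tr τ) τ - det τ`, which is `τ` here. -/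
theorem IsState.isStarProjection {τ : Op} (h : IsState τ) (hd : τ.det = 0) :
    IsStarProjection τ := by
  refine ⟨?_, h.1.isHermitian⟩
  have ht := h.2
  rw [Matrix.trace_fin_two] at ht
  rw [Matrix.det_fin_two] at hd
  change τ * τ = τ
  ext i j
  fin_cases i <;> fin_cases j <;> simp [Matrix.mul_apply, Fin.sum_univ_two]
  · linear_combination τ 0 0 * ht - hd
  · linear_combination τ 0 1 * ht
  · linear_combination τ 1 0 * ht
  · linear_combination τ 1 1 * ht - hd

/-- When the two eigenvalues of `A` differ, reaching the trace `opNorm A` leaves `τ` no weight on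
the eigenvector of the smaller one. A positive matrix with a zero diagonal entry is singular, and a
singular qubit state is a projection. -/
theorem IsState.isStarProjection_of_trace_mul {A τ : Op} (hA : IsState A) (hτ : IsState τ)
    (h : (A * τ).trace = (opNorm A : ℂ)) (hne : opNorm A ≠ 1 / 2) : IsStarProjection τ := by
  apply hτ.isStarProjection
  set U : Op := (hA.1.isHermitian.eigenvectorUnitary : Op) with hU
  have hUU : U * Uᴴ = 1 := Unitary.coe_mul_star_self hA.1.isHermitian.eigenvectorUnitary
  obtain ⟨i, j, hij, hi, hj, hh, -⟩ := hA.exists_eigenvalue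
  have hP := hτ.1.conjTranspose_mul_mul_same U
  have ht : (Uᴴ * τ * U).trace = 1 := by
    rw [mul_assoc, Matrix.trace_mul_comm, mul_assoc, hUU, mul_one, hτ.2]
  have hdet : (Uᴴ * τ * U).det = τ.det := by
    have := congrArg Matrix.det hUU
    rw [Matrix.det_mul, Matrix.det_one] at this
    rw [Matrix.det_mul, Matrix.det_mul]
    linear_combination τ.det * this
  rw [trace_mul_eq_sum_eigenvalues hA.1.isHermitian, sum_fin_two_of_ne _ hij, hi, hj, ← hU] at h
  rw [← hdet]
  set T := Uᴴ * τ * U with hT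
  rw [Matrix.trace, sum_fin_two_of_ne _ hij] at ht
  simp only [Matrix.diag] at ht
  have h0 : T j j = 0 := by
    have : ((1 - 2 * opNorm A : ℝ) : ℂ) * T j j = 0 := by
      push_cast at h ⊢
      linear_combination h - opNorm A * ht
    rcases mul_eq_zero.1 this with h' | h'
    · rw [Complex.ofReal_eq_zero] at h'
      exact absurd (by linarith) hne
    · exact h'
  have hd : T.det = -(T i j * star (T i j)) := by
    rw [show star (T i j) = T j i from hP.isHermitian.apply j i, Matrix.det_fin_two]
    fin_cases i <;> fin_cases j <;> first | exact absurd rfl hij | skip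
    · simp only [Fin.mk_one, Fin.zero_eta] at h0 ⊢
      rw [h0]; ring
    · simp only [Fin.mk_one, Fin.zero_eta] at h0 ⊢
      rw [h0]; ring
  -- With one diagonal entry zero, the determinant is minus a squared modulus, while positivity
  -- makes it nonnegative.
  refine le_antisymm ?_ hP.det_nonneg
  rw [hd]
  exact neg_nonpos.2 (mul_star_self_nonneg _)

theorem IsState.exists_projection {A : Op} (hA : IsState A) :
    ∃ τ, IsState τ ∧ (A * τ).trace = (opNorm A : ℂ) ∧ IsStarProjection τ := by
  obtain ⟨i, j, hij, hi, hj, hh, -⟩ := hA.exists_eigenvalue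
  set U : Op := (hA.1.isHermitian.eigenvectorUnitary : Op) with hU
  have hUU : Uᴴ * U = 1 := Unitary.coe_star_mul_self hA.1.isHermitian.eigenvectorUnitary
  have hUU' : U * Uᴴ = 1 := Unitary.coe_mul_star_self hA.1.isHermitian.eigenvectorUnitary
  -- The witness is the projector onto the eigenvector of the larger eigenvalue.
  set D : Op := Matrix.diagonal (Pi.single i 1) with hD
  have hDP : D.PosSemidef := by
    refine Matrix.PosSemidef.diagonal ?_
    intro k
    by_cases hk : k = i <;> simp [hk]
  have hst : IsState (U * D * Uᴴ) := by
    refine ⟨hDP.mul_mul_conjTranspose_same U, ?_⟩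
    rw [mul_assoc, Matrix.trace_mul_comm, mul_assoc, hUU, mul_one, Matrix.trace_diagonal]
    simp
  refine ⟨_, hst, ?_, hst.isStarProjection ?_⟩
  · rw [trace_mul_eq_sum_eigenvalues hA.1.isHermitian, ← hU]
    rw [show Uᴴ * (U * D * Uᴴ) * U = (Uᴴ * U) * D * (Uᴴ * U) by simp only [mul_assoc], hUU,
      one_mul, mul_one, sum_fin_two_of_ne _ hij, hi]
    simp [hD, hij.symm]
  · rw [Matrix.det_mul, Matrix.det_mul, hD, Matrix.det_diagonal,
      Finset.prod_eq_zero (Finset.mem_univ j) (by simp [hij.symm])]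
    simp

/-! ### Compactness of the state space -/

theorem continuous_opNorm_comp (Φ : Op →ₗ[ℂ] Op) : Continuous fun ρ => opNorm (Φ ρ) :=
  (((Matrix.toEuclideanCLM (n := Fin 2) (𝕜 := ℂ)).toAlgEquiv.toLinearMap ∘ₗ
    Φ).continuous_of_finiteDimensional).norm

theorem isClosed_setOf_isState : IsClosed {ρ : Op | IsState ρ} := by
  have : {ρ : Op | IsState ρ} = {ρ : Op | ρᴴ = ρ} ∩
      (⋂ x : Fin 2 → ℂ, {ρ : Op | 0 ≤ star x ⬝ᵥ (ρ *ᵥ x)}) ∩ {ρ | ρ.trace = 1} := by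
    ext ρ
    simp only [IsState, Matrix.posSemidef_iff_dotProduct_mulVec, Set.mem_ofPred_eq, Set.mem_inter_iff,
      Set.mem_iInter]
    rfl
  rw [this]
  refine ((isClosed_eq (by fun_prop) continuous_id).inter (isClosed_iInter fun x => ?_)).inter
    (isClosed_eq (by fun_prop) continuous_const)
  exact isClosed_le continuous_const
    (continuous_const.dotProduct (continuous_id.matrix_mulVec continuous_const))

theorem IsState.norm_apply_le {ρ : Op} (h : IsState ρ) (i j : Fin 2) : ‖ρ i j‖ ≤ 1 := by
  have hd := h.1.det_nonneg
  have h0 := h.1.diag_nonneg (i := 0)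
  have h1 := h.1.diag_nonneg (i := 1)
  have ht := h.2
  rw [Matrix.trace_fin_two] at ht
  have h10 : ρ 1 0 = star (ρ 0 1) := (h.1.isHermitian.apply 1 0).symm
  obtain ⟨a, ha⟩ : ∃ a : ℝ, ρ 0 0 = a := ⟨_, (Complex.eq_re_of_ofReal_le (r := 0) (by simpa using h0))⟩
  obtain ⟨b, hb⟩ : ∃ a : ℝ, ρ 1 1 = a := ⟨_, (Complex.eq_re_of_ofReal_le (r := 0) (by simpa using h1))⟩
  rw [Matrix.det_fin_two, h10, ha, hb, Complex.star_def, Complex.mul_conj,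
    Complex.normSq_eq_norm_sq] at hd
  rw [ha, hb] at ht
  rw [ha] at h0
  rw [hb] at h1
  norm_cast at hd ht h0 h1
  -- Nonnegative determinant gives `‖ρ 0 1‖² ≤ a * b`, with `a + b = 1`.
  have hn : ‖ρ 0 1‖ ≤ 1 := by nlinarith [norm_nonneg (ρ 0 1)]
  fin_cases i <;> fin_cases j <;> simp
  · rw [ha, Complex.norm_real, Real.norm_eq_abs, abs_of_nonneg h0]; linarith
  · exact hn
  · rw [h10, norm_star]; exact hn
  · rw [hb, Complex.norm_real, Real.norm_eq_abs, abs_of_nonneg h1]; linarith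

theorem isCompact_setOf_isState : IsCompact {ρ : Op | IsState ρ} := by
  have : IsCompact (Set.univ.pi fun _ : Fin 2 => Set.univ.pi fun _ : Fin 2 =>
      Metric.closedBall (0 : ℂ) 1) :=
    isCompact_univ_pi fun _ => isCompact_univ_pi fun _ => isCompact_closedBall _ _
  refine this.of_isClosed_subset isClosed_setOf_isState ?_
  intro ρ hρ i _ j _
  rw [mem_closedBall_zero_iff]
  exact IsState.norm_apply_le hρ i j

/-! ### Maximal output norm, Holevo information and the induced channel -/

section Channel

variable {Φ : Op →ₗ[ℂ] Op}

theorem IsUnitalQubitChannel.bddAbove_outputNorms (hΦ : IsUnitalQubitChannel Φ) :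
    BddAbove (outputNorms Φ) := by
  refine ⟨1, ?_⟩
  rintro _ ⟨ρ, hρ, rfl⟩
  exact (hΦ.map_isState hρ).opNorm_le_one

theorem IsUnitalQubitChannel.opNorm_le (hΦ : IsUnitalQubitChannel Φ) {ρ : Op} (hρ : IsState ρ) :
    opNorm (Φ ρ) ≤ maxOutputNorm Φ :=
  le_csSup hΦ.bddAbove_outputNorms ⟨ρ, hρ, rfl⟩

theorem normMaximizers_nonempty (hΦ : IsUnitalQubitChannel Φ) : (normMaximizers Φ).Nonempty := by
  obtain ⟨ρ, hρ, hmax⟩ := isCompact_setOf_isState.exists_isMaxOn ⟨_, isState_half⟩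
    (continuous_opNorm_comp Φ).continuousOn
  refine ⟨ρ, hρ, le_antisymm (hΦ.opNorm_le hρ) (csSup_le ⟨_, ρ, hρ, rfl⟩ ?_)⟩
  rintro _ ⟨σ, hσ, rfl⟩
  exact hmax hσ

theorem IsUnitalQubitChannel.maxOutputNorm_mem (hΦ : IsUnitalQubitChannel Φ) :
    maxOutputNorm Φ ∈ Set.Icc (1 / 2 : ℝ) 1 := by
  obtain ⟨ρ, hρ, h⟩ := normMaximizers_nonempty hΦ
  rw [← h]
  exact ⟨(hΦ.map_isState hρ).half_le_opNorm, (hΦ.map_isState hρ).opNorm_le_one⟩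

/-- The bound uses the two entropy terms separately: one bit for the average output, `h(M_Φ)` from
below for each signal. An antipodal pair with equal weights saturates both at once. -/
theorem IsUnitalQubitChannel.isGreatest_holevoValues (hΦ : IsUnitalQubitChannel Φ) :
    IsGreatest (holevoValues Φ) (1 - binaryEntropy (maxOutputNorm Φ)) := by
  constructor
  · obtain ⟨ρ, hρ, h⟩ := normMaximizers_nonempty hΦ
    refine ⟨1 / 2, ρ, 1 - ρ, by norm_num, by norm_num, hρ, hρ.one_sub, ?_⟩
    have h1 : (1 / 2 : ℝ) • ρ + (1 - 1 / 2 : ℝ) • (1 - ρ) = (1 / 2 : ℝ) • (1 : Op) := by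
      rw [show (1 - 1 / 2 : ℝ) = 1 / 2 by norm_num, ← smul_add]; simp
    have h2 : Φ ((1 / 2 : ℝ) • (1 : Op)) = (1 / 2 : ℝ) • (1 : Op) := by
      rw [LinearMap.map_smul_of_tower, hΦ.unital]
    rw [h1, h2, vonNeumannEntropy_half, map_sub, hΦ.unital,
      (hΦ.map_isState hρ).vonNeumannEntropy_one_sub, (hΦ.map_isState hρ).vonNeumannEntropy_eq, h]
    ring
  · rintro _ ⟨p, ρ, σ, h0, h1, hρ, hσ, rfl⟩
    have key : ∀ {ρ : Op}, IsState ρ →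
        binaryEntropy (maxOutputNorm Φ) ≤ vonNeumannEntropy (Φ ρ) := fun {ρ} h => by
      rw [(hΦ.map_isState h).vonNeumannEntropy_eq]
      exact binaryEntropy_anti (hΦ.map_isState h).half_le_opNorm (hΦ.opNorm_le h)
        hΦ.maxOutputNorm_mem.2
    have hm : vonNeumannEntropy (Φ (p • ρ + (1 - p) • σ)) ≤ 1 := by
      rw [(hΦ.map_isState (hρ.mix hσ h0 h1)).vonNeumannEntropy_eq]
      exact binaryEntropy_le_one _
    nlinarith [mul_le_mul_of_nonneg_left (key hρ) h0,
      mul_le_mul_of_nonneg_left (key hσ) (sub_nonneg.2 h1)]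

theorem exists_projection_mem_detectors (hΦ : IsUnitalQubitChannel Φ) {ρ : Op}
    (hρ : ρ ∈ normMaximizers Φ) : ∃ τ ∈ detectors Φ ρ, IsStarProjection τ := by
  obtain ⟨τ, hτ, h, hp⟩ := (hΦ.map_isState hρ.1).exists_projection
  exact ⟨τ, ⟨hτ, by rw [h, hρ.2]⟩, hp⟩

theorem isStarProjection_measurement (hΦ : IsUnitalQubitChannel Φ) {ρ τ : Op}
    (hρ : ρ ∈ normMaximizers Φ) (hτ : τ ∈ detectors Φ ρ) (hne : maxOutputNorm Φ ≠ 1 / 2)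
    (y : Fin 2) : IsStarProjection (measurement τ y) := by
  have h : IsStarProjection τ := (hΦ.map_isState hρ.1).isStarProjection_of_trace_mul hτ.1
    (by rw [hρ.2]; exact hτ.2) (by rwa [hρ.2])
  fin_cases y
  · exact h.one_sub
  · exact h

theorem isPOVM_measurement {τ : Op} (hτ : IsState τ) : IsPOVM (measurement τ) := by
  refine ⟨fun y => ?_, by simp [measurement]⟩
  fin_cases y
  · exact hτ.one_sub.1
  · exact hτ.1

theorem isState_encoder {ρ : Op} (hρ : IsState ρ) (x : Fin 2) : IsState (encoder ρ x) := by
  fin_cases x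
  · exact hρ
  · exact hρ.one_sub

/-- Bit `0` triggers outcome `1` with probability `M_Φ`, so `M_Φ` is the flip probability. The
identity is kept complex-valued so that it can be multiplied over the qubits before taking real
parts. -/
theorem trace_measurement_mul (hΦ : IsUnitalQubitChannel Φ) {ρ τ : Op}
    (hρ : ρ ∈ normMaximizers Φ) (hτ : τ ∈ detectors Φ ρ) (x y : Fin 2) :
    (measurement τ y * Φ (encoder ρ x)).trace = (bsc (maxOutputNorm Φ) x y : ℂ) := by
  have h : (τ * Φ ρ).trace = maxOutputNorm Φ := by rw [Matrix.trace_mul_comm]; exact hτ.2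
  have h' : (τ * Φ (1 - ρ)).trace = 1 - maxOutputNorm Φ := by
    rw [map_sub, hΦ.unital, mul_sub, mul_one, Matrix.trace_sub, h, hτ.1.2]
  have t : (Φ ρ).trace = 1 := (hΦ.map_isState hρ.1).2
  have t' : (Φ (1 - ρ)).trace = 1 := (hΦ.map_isState hρ.1.one_sub).2
  fin_cases x <;> fin_cases y <;>
    simp [measurement, encoder, bsc, trace_one_sub_mul, h, h', t, t', -map_sub]

theorem inducedChannel_eq_bsc (hΦ : IsUnitalQubitChannel Φ) {ρ τ : Op}
    (hρ : ρ ∈ normMaximizers Φ) (hτ : τ ∈ detectors Φ ρ) :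
    inducedChannel Φ (encoder ρ) (measurement τ) = bsc (maxOutputNorm Φ) := by
  funext x y
  rw [inducedChannel, trace_measurement_mul hΦ hρ hτ, Complex.ofReal_re]

end Channel

/-! ### Product operators and tensor powers -/

theorem productOp_mul {n : ℕ} (A B : Fin n → Op) :
    productOp A * productOp B = productOp fun i => A i * B i := by
  ext a b
  simp only [Matrix.mul_apply, productOp, Matrix.of_apply, Finset.prod_univ_sum,
    Fintype.piFinset_univ, Finset.prod_mul_distrib]

theorem trace_productOp {n : ℕ} (A : Fin n → Op) : (productOp A).trace = ∏ i, (A i).trace := by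
  simp only [Matrix.trace, productOp, Matrix.diag, Matrix.of_apply, Finset.prod_univ_sum,
    Fintype.piFinset_univ]

theorem linearMap_apply_eq_sum (Φ : Op →ₗ[ℂ] Op) (A : Op) (c d : Fin 2) :
    Φ A c d = ∑ a, ∑ b, A a b * Φ (Matrix.single a b 1) c d := by
  conv_lhs => rw [Matrix.matrix_eq_sum_single A]
  have : ∀ a b, Matrix.single a b (A a b) = A a b • Matrix.single a b (1 : ℂ) := fun a b => by
    rw [Matrix.smul_single, smul_eq_mul, mul_one]
  simp only [this, map_sum, map_smul, Matrix.sum_apply, Matrix.smul_apply, smul_eq_mul]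

/-- Expanding each `Φ (A i)` in matrix units and multiplying out gives exactly the double sum that
defines `tensorPower`. -/
theorem tensorPower_productOp (Φ : Op →ₗ[ℂ] Op) {n : ℕ} (A : Fin n → Op) :
    tensorPower Φ n (productOp A) = productOp fun i => Φ (A i) := by
  ext c d
  simp only [tensorPower, Matrix.sum_apply, Matrix.smul_apply, productOp, Matrix.of_apply,
    smul_eq_mul, ← Finset.prod_mul_distrib]
  simp only [linearMap_apply_eq_sum Φ (A _), Finset.prod_univ_sum, Fintype.piFinset_univ]

theorem inducedBlockChannel_eq_memoryless {Φ : Op →ₗ[ℂ] Op} (hΦ : IsUnitalQubitChannel Φ)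
    {ρ τ : Op} (hρ : ρ ∈ normMaximizers Φ) (hτ : τ ∈ detectors Φ ρ) (n : ℕ) :
    inducedBlockChannel Φ (encoder ρ) (measurement τ) n
      = memoryless (bsc (maxOutputNorm Φ)) n := by
  funext x y
  rw [inducedBlockChannel, tensorPower_productOp, productOp_mul, trace_productOp]
  simp only [trace_measurement_mul hΦ hρ hτ]
  rw [← Complex.ofReal_prod, Complex.ofReal_re, memoryless]

/-! ### Mutual information of the binary symmetric channel -/

theorem shannonEntropy_eq_sum_negMulLog {X : Type*} [Fintype X] (p : X → ℝ) :
    shannonEntropy p = (∑ x, Real.negMulLog (p x)) / Real.log 2 := by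
  rw [shannonEntropy, Finset.sum_div, ← Finset.sum_neg_distrib]
  refine Finset.sum_congr rfl fun x _ => ?_
  rw [Real.negMulLog, Real.logb]
  ring

theorem shannonEntropy_fin_two {p : Fin 2 → ℝ} (h : p 0 + p 1 = 1) :
    shannonEntropy p = binaryEntropy (p 0) := by
  rw [shannonEntropy, Fin.sum_univ_two, binaryEntropy, ← h, add_sub_cancel_left]

/-- The output entropy minus the conditional entropy of the noise. -/
theorem mutualInformation_bsc {q : ℝ} {p : Fin 2 → ℝ} (hp : p 0 + p 1 = 1) :
    mutualInformation (bsc q) p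
      = binaryEntropy (p 0 * (1 - q) + p 1 * q) - binaryEntropy q := by
  have hY : shannonEntropy (fun y => ∑ x, p x * bsc q x y)
      = binaryEntropy (p 0 * (1 - q) + p 1 * q) := by
    rw [shannonEntropy_fin_two]
    · simp [bsc, Fin.sum_univ_two]
    · simp [bsc, Fin.sum_univ_two]; linear_combination hp
  rw [mutualInformation, hY, shannonEntropy_eq_sum_negMulLog, shannonEntropy_eq_sum_negMulLog,
    binaryEntropy_eq q, Real.binEntropy_eq_negMulLog_add_negMulLog_one_sub]
  -- The product rule for `negMulLog` also holds at zero, so the joint entropy splits without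
  -- treating null events apart.
  simp only [Fintype.sum_prod_type, Fin.sum_univ_two, Real.negMulLog_mul, bsc]
  simp
  have h1 : p 1 = 1 - p 0 := by linarith
  rw [h1]
  ring

theorem isGreatest_mutualInformations_bsc (q : ℝ) :
    IsGreatest (mutualInformations (bsc q)) (1 - binaryEntropy q) := by
  constructor
  · refine ⟨fun _ => 1 / 2, ⟨fun _ => by norm_num, by norm_num [Fin.sum_univ_two]⟩, ?_⟩
    rw [mutualInformation_bsc (by norm_num)]
    rw [show (1 / 2 : ℝ) * (1 - q) + 1 / 2 * q = 1 / 2 by ring, binaryEntropy_half]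
  · rintro _ ⟨p, hp, rfl⟩
    rw [mutualInformation_bsc (by rw [← Fin.sum_univ_two]; exact hp.2)]
    linarith [binaryEntropy_le_one (p 0 * (1 - q) + p 1 * q)]

theorem shannonCapacity_bsc (q : ℝ) : shannonCapacity (bsc q) = 1 - binaryEntropy q :=
  (isGreatest_mutualInformations_bsc q).csSup_eq

/-! ### Coding for the binary symmetric channel -/

theorem sum_prod_eq_one {n : ℕ} {α : Type*} [Fintype α] [DecidableEq α] {w : Fin n → α → ℝ}
    (hw : ∀ i, ∑ a, w i a = 1) : ∑ y : Fin n → α, ∏ i, w i (y i) = 1 := by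
  rw [← Fintype.piFinset_univ, ← Finset.prod_univ_sum]
  simp [hw]

theorem sum_prod_mul_sum_eq_zero {α : Type*} [Fintype α] [DecidableEq α] {n : ℕ}
    {w f : Fin n → α → ℝ} (hw : ∀ i, ∑ a, w i a = 1) (hf : ∀ i, ∑ a, w i a * f i a = 0) :
    ∑ y : Fin n → α, (∏ i, w i (y i)) * ∑ i, f i (y i) = 0 := by
  induction n with
  | zero => simp
  | succ n ih =>
    rw [← (Fin.consEquiv fun _ => α).sum_comp, Fintype.sum_prod_type]
    simp only [Fin.consEquiv_apply, Fin.prod_univ_succ, Fin.sum_univ_succ, Fin.cons_zero,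
      Fin.cons_succ]
    have e : ∀ a (y : Fin n → α), (w 0 a * ∏ i : Fin n, w i.succ (y i)) *
        (f 0 a + ∑ i : Fin n, f i.succ (y i)) = w 0 a * f 0 a * ∏ i : Fin n, w i.succ (y i) +
        w 0 a * ((∏ i : Fin n, w i.succ (y i)) * ∑ i : Fin n, f i.succ (y i)) :=
      fun a y => by ring
    simp only [e, Finset.sum_add_distrib, ← Finset.mul_sum, ih (fun i => hw i.succ)
      (fun i => hf i.succ), sum_prod_eq_one (fun i : Fin n => hw i.succ), mul_one, mul_zero, hf,
      add_zero]

/-- The variance of a sum of independent centred random variables. -/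
theorem sum_prod_mul_sum_sq {α : Type*} [Fintype α] [DecidableEq α] {n : ℕ}
    {w f : Fin n → α → ℝ} (hw : ∀ i, ∑ a, w i a = 1) (hf : ∀ i, ∑ a, w i a * f i a = 0) :
    ∑ y : Fin n → α, (∏ i, w i (y i)) * (∑ i, f i (y i)) ^ 2
      = ∑ i, ∑ a, w i a * f i a ^ 2 := by
  induction n with
  | zero => simp
  | succ n ih =>
    rw [← (Fin.consEquiv fun _ => α).sum_comp, Fintype.sum_prod_type]
    simp only [Fin.consEquiv_apply, Fin.prod_univ_succ, Fin.sum_univ_succ, Fin.cons_zero,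
      Fin.cons_succ]
    have e : ∀ a (y : Fin n → α), (w 0 a * ∏ i : Fin n, w i.succ (y i)) *
        (f 0 a + ∑ i : Fin n, f i.succ (y i)) ^ 2
          = w 0 a * f 0 a ^ 2 * ∏ i : Fin n, w i.succ (y i) +
        2 * (w 0 a * f 0 a) * ((∏ i : Fin n, w i.succ (y i)) * ∑ i : Fin n, f i.succ (y i)) +
        w 0 a * ((∏ i : Fin n, w i.succ (y i)) * (∑ i : Fin n, f i.succ (y i)) ^ 2) :=
      fun a y => by ring
    simp only [e, Finset.sum_add_distrib, ← Finset.mul_sum,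
      sum_prod_mul_sum_eq_zero (fun i : Fin n => hw i.succ) (fun i => hf i.succ),
      sum_prod_eq_one (fun i : Fin n => hw i.succ), mul_one, mul_zero, ih (fun i => hw i.succ)
      (fun i => hf i.succ), ← Finset.sum_mul, hw, one_mul, add_zero]

open Classical in
/-- **Chebyshev's inequality** for sums of independent centred random variables. -/
theorem sum_prod_filter_le {α : Type*} [Fintype α] [DecidableEq α] {n : ℕ}
    {w f : Fin n → α → ℝ} (h0 : ∀ i a, 0 ≤ w i a) (hw : ∀ i, ∑ a, w i a = 1)
    (hf : ∀ i, ∑ a, w i a * f i a = 0) {V : ℝ} (hV : ∀ i, ∑ a, w i a * f i a ^ 2 = V)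
    {t : ℝ} (ht : 0 < t) :
    ∑ y : Fin n → α with ∑ i, f i (y i) ≤ -t, ∏ i, w i (y i) ≤ n * V / t ^ 2 := by
  rw [le_div_iff₀ (by positivity), Finset.sum_mul]
  have h := sum_prod_mul_sum_sq hw hf
  simp only [hV, Finset.sum_const, Finset.card_univ, Fintype.card_fin, nsmul_eq_mul] at h
  rw [← h]
  have hp : ∀ y : Fin n → α, 0 ≤ ∏ i, w i (y i) := fun y => Finset.prod_nonneg fun i _ => h0 i _
  refine (Finset.sum_le_sum fun y hy => ?_).trans
    (Finset.sum_le_univ_sum_of_nonneg fun y => mul_nonneg (hp y) (sq_nonneg _))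
  rw [Finset.mem_filter] at hy
  exact mul_le_mul_of_nonneg_left (by nlinarith [hy.2]) (hp y)

section BSC

variable {q : ℝ}

theorem bsc_nonneg (h0 : 0 ≤ q) (h1 : q ≤ 1) (x y : Fin 2) : 0 ≤ bsc q x y := by
  rw [bsc]; split_ifs <;> linarith

theorem sum_bsc_mul (q : ℝ) (x : Fin 2) (g : ℝ → ℝ) :
    ∑ y, bsc q x y * g (bsc q x y) = q * g q + (1 - q) * g (1 - q) := by
  fin_cases x <;> simp [bsc, Fin.sum_univ_two, add_comm]

theorem sum_bsc_right (q : ℝ) (x : Fin 2) : ∑ y, bsc q x y = 1 := by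
  simpa using sum_bsc_mul q x fun _ => 1

theorem bsc_comm (q : ℝ) (x y : Fin 2) : bsc q x y = bsc q y x := by
  simp only [bsc, eq_comm]

theorem memoryless_nonneg {W : Fin 2 → Fin 2 → ℝ} (h : ∀ x y, 0 ≤ W x y) {n : ℕ}
    (x y : Fin n → Fin 2) : 0 ≤ memoryless W n x y :=
  Finset.prod_nonneg fun _ _ => h _ _

theorem sum_memoryless_bsc_right (q : ℝ) {n : ℕ} (x : Fin n → Fin 2) :
    ∑ y, memoryless (bsc q) n x y = 1 :=
  sum_prod_eq_one (w := fun i => bsc q (x i)) fun i => sum_bsc_right q (x i)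

theorem sum_memoryless_bsc_left (q : ℝ) {n : ℕ} (y : Fin n → Fin 2) :
    ∑ x, memoryless (bsc q) n x y = 1 := by
  simp only [memoryless, bsc_comm q _ (y _)]
  exact sum_memoryless_bsc_right q y

/-- The variance of the information content of the noise of a binary symmetric channel. -/
noncomputable def noiseVariance (q : ℝ) : ℝ :=
  q * (Real.logb 2 q + binaryEntropy q) ^ 2
    + (1 - q) * (Real.logb 2 (1 - q) + binaryEntropy q) ^ 2

theorem noiseVariance_nonneg (h0 : 0 ≤ q) (h1 : q ≤ 1) : 0 ≤ noiseVariance q :=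
  add_nonneg (mul_nonneg h0 (sq_nonneg _)) (mul_nonneg (sub_nonneg.2 h1) (sq_nonneg _))

open Classical in
/-- The probability of a noise pattern that is too unlikely. -/
theorem sum_memoryless_atypical_le (h0 : 0 ≤ q) (h1 : q ≤ 1) {n : ℕ} (x : Fin n → Fin 2)
    {t : ℝ} (ht : 0 < t) :
    ∑ y with memoryless (bsc q) n x y ≤ (2 : ℝ) ^ (-(n * binaryEntropy q) - t),
      memoryless (bsc q) n x y ≤ n * noiseVariance q / t ^ 2 := by
  set f : Fin n → Fin 2 → ℝ := fun i y => Real.logb 2 (bsc q (x i) y) + binaryEntropy q with hf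
  have hc := sum_prod_filter_le (w := fun i => bsc q (x i)) (f := f) (V := noiseVariance q)
    (fun i => bsc_nonneg h0 h1 (x i)) (fun i => sum_bsc_right q (x i))
    (fun i => by
      rw [hf]
      refine (sum_bsc_mul q (x i) fun z => Real.logb 2 z + binaryEntropy q).trans ?_
      rw [binaryEntropy]; ring)
    (fun i => (sum_bsc_mul q (x i) fun z => (Real.logb 2 z + binaryEntropy q) ^ 2)) ht
  refine le_trans ?_ hc
  rw [Finset.sum_filter, Finset.sum_filter]
  refine Finset.sum_le_sum fun y _ => ?_
  have hn : 0 ≤ memoryless (bsc q) n x y := memoryless_nonneg (bsc_nonneg h0 h1) x y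
  split_ifs with ha hb hb
  · exact le_rfl
  · rcases hn.eq_or_lt with h | h
    · exact h.ge
    · refine absurd ?_ hb
      have hne : ∀ i ∈ Finset.univ, bsc q (x i) (y i) ≠ 0 := Finset.prod_ne_zero_iff.1 h.ne'
      have hl : Real.logb 2 (memoryless (bsc q) n x y) = ∑ i, Real.logb 2 (bsc q (x i) (y i)) :=
        Real.logb_prod _ _ hne
      have := (Real.logb_le_iff_le_rpow one_lt_two h).2 ha
      rw [hl] at this
      simp only [hf, Finset.sum_add_distrib, Finset.sum_const, Finset.card_univ, Fintype.card_fin,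
        nsmul_eq_mul]
      linarith
  · exact hn
  · exact le_rfl

end BSC

/-- **Feinstein's greedy construction**: as long as the decoding sets do not exhaust the typical
outputs, another codeword with a small error probability can be found. -/
theorem exists_decoding_sets {X : Type*} [Fintype X] [DecidableEq X] [Nonempty X]
    {W : X → X → ℝ} (h0 : ∀ x y, 0 ≤ W x y) (hr : ∀ x, ∑ y, W x y = 1)
    (hl : ∀ y, ∑ x, W x y = 1) {s δ ε : ℝ} (hs : 0 < s) {B : X → Finset X}
    (hB : ∀ x, ∀ y ∈ B x, s ≤ W x y) (hδ : ∀ x, 1 - δ ≤ ∑ y ∈ B x, W x y) (K : ℕ)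
    (hK : (K : ℝ) ≤ s * Fintype.card X * (ε - δ) + 1) :
    ∃ (x : Fin K → X) (D : Fin K → Finset X), Pairwise (fun i j => Disjoint (D i) (D j)) ∧
      (∀ i, D i ⊆ B (x i)) ∧ ∀ i, 1 - ε ≤ ∑ y ∈ D i, W (x i) y := by
  induction K with
  | zero => exact ⟨Fin.elim0, Fin.elim0, fun i => i.elim0, fun i => i.elim0, fun i => i.elim0⟩
  | succ K ih =>
    push_cast at hK
    obtain ⟨x, D, hdisj, hsub, herr⟩ := ih (by linarith)
    set U : Finset X := Finset.univ.biUnion D with hU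
    have hcard : (U.card : ℝ) * s ≤ K := by
      have hb : ∀ i, ((D i).card : ℝ) * s ≤ 1 := fun i => by
        rw [← nsmul_eq_mul, ← hr (x i)]
        exact (Finset.card_nsmul_le_sum _ _ _ fun y hy => hB _ y (hsub i hy)).trans
          (Finset.sum_le_univ_sum_of_nonneg fun y => h0 _ y)
      have h1 : (U.card : ℝ) ≤ ∑ i, ((D i).card : ℝ) := by
        exact_mod_cast Finset.card_biUnion_le
      calc (U.card : ℝ) * s ≤ (∑ i, ((D i).card : ℝ)) * s := mul_le_mul_of_nonneg_right h1 hs.le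
        _ = ∑ i, ((D i).card : ℝ) * s := Finset.sum_mul _ _ _
        _ ≤ ∑ _i : Fin K, 1 := Finset.sum_le_sum fun i _ => hb i
        _ = K := by simp
    have hX : (0 : ℝ) < Fintype.card X := by exact_mod_cast Fintype.card_pos
    have hUavg : ∑ x, ∑ y ∈ U, W x y = U.card := by
      rw [Finset.sum_comm]; simp [hl]
    obtain ⟨z, hz⟩ : ∃ z, 1 - ε ≤ ∑ y ∈ B z \ U, W z y := by
      by_contra! hcon
      have h1 : ∀ z, 1 - δ ≤ ∑ y ∈ B z \ U, W z y + ∑ y ∈ U, W z y := fun z => by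
        refine (hδ z).trans ?_
        rw [← Finset.sum_union Finset.sdiff_disjoint]
        exact Finset.sum_le_sum_of_subset_of_nonneg (by simp) fun y _ _ => h0 z y
      have h2 : ∑ _z : X, (1 - δ) < ∑ z, ((1 - ε) + ∑ y ∈ U, W z y) :=
        Finset.sum_lt_sum_of_nonempty Finset.univ_nonempty fun z _ => by
          linarith [h1 z, hcon z]
      rw [Finset.sum_add_distrib, hUavg] at h2
      simp only [Finset.sum_const, Finset.card_univ, nsmul_eq_mul] at h2
      nlinarith
    refine ⟨Fin.cons z x, Fin.cons (B z \ U) D, ?_, ?_, ?_⟩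
    · have hd : ∀ i, Disjoint (B z \ U) (D i) := fun i =>
        Finset.sdiff_disjoint.mono_right (Finset.subset_biUnion_of_mem D (Finset.mem_univ i))
      intro i j hij
      induction i using Fin.cases with
      | zero =>
        induction j using Fin.cases with
        | zero => exact absurd rfl hij
        | succ j => simpa using hd j
      | succ i =>
        induction j using Fin.cases with
        | zero => simpa using (hd i).symm
        | succ j => simpa using hdisj (fun h => hij (congrArg _ h))
    · intro i
      induction i using Fin.cases with
      | zero => simp
      | succ i => simpa using hsub i
    · intro i
      induction i using Fin.cases with
      | zero => simpa using hz
      | succ i => simpa using herr i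

theorem exists_blockCode_of_decoding_sets {n K : ℕ} [NeZero K]
    {V : (Fin n → Fin 2) → (Fin n → Fin 2) → ℝ} (h0 : ∀ x y, 0 ≤ V x y)
    (hr : ∀ x, ∑ y, V x y = 1) {ε : ℝ} (x : Fin K → Fin n → Fin 2)
    (D : Fin K → Finset (Fin n → Fin 2)) (hD : Pairwise fun i j => Disjoint (D i) (D j))
    (herr : ∀ i, 1 - ε ≤ ∑ y ∈ D i, V (x i) y) :
    ∃ c : BlockCode n, c.size = K ∧ ∀ m, errorProb V c m ≤ ε := by
  classical
  refine ⟨⟨K, x, fun y => if h : ∃ i, y ∈ D i then h.choose else 0⟩, rfl, fun m => ?_⟩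
  have hdec : ∀ y ∈ D m, (if h : ∃ i, y ∈ D i then h.choose else 0) = m := fun y hy => by
    have h : ∃ i, y ∈ D i := ⟨m, hy⟩
    rw [dif_pos h]
    by_contra hne
    exact Finset.disjoint_left.1 (hD hne) h.choose_spec hy
  have hle : errorProb V ⟨K, x, fun y => if h : ∃ i, y ∈ D i then h.choose else 0⟩ m
      ≤ ∑ y, (V (x m) y - if y ∈ D m then V (x m) y else 0) := by
    refine Finset.sum_le_sum fun y _ => ?_
    by_cases hy : y ∈ D m
    · simp only [hdec y hy, hy, if_true, sub_self, le_refl]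
    · simp only [hy, if_false, sub_zero]
      split_ifs
      all_goals first | exact h0 _ _ | exact le_rfl
  rw [Finset.sum_sub_distrib, hr, Finset.sum_ite_mem, Finset.univ_inter] at hle
  linarith [herr m]

/-- A finite-length coding theorem for the binary symmetric channel. -/
theorem exists_blockCode_bsc {q : ℝ} (h0 : 0 ≤ q) (h1 : q ≤ 1) (n : ℕ) {t ε : ℝ} (ht : 0 < t)
    (hε : 2 * (n * noiseVariance q / t ^ 2) ≤ ε) :
    ∃ c : BlockCode n,
      c.size = ⌊(2 : ℝ) ^ (n * (1 - binaryEntropy q) - t) * (ε / 2)⌋₊ + 1 ∧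
      ∀ m, errorProb (memoryless (bsc q) n) c m ≤ ε := by
  classical
  have hW : ∀ x y, 0 ≤ memoryless (bsc q) n x y := memoryless_nonneg (bsc_nonneg h0 h1)
  have hV := noiseVariance_nonneg h0 h1
  have hε0 : 0 ≤ ε := le_trans (by positivity) hε
  set s : ℝ := (2 : ℝ) ^ (-(n * binaryEntropy q) - t) with hs
  have hs0 : 0 < s := Real.rpow_pos_of_pos two_pos _
  have hcard : s * Fintype.card (Fin n → Fin 2) = (2 : ℝ) ^ (n * (1 - binaryEntropy q) - t) := by
    rw [Fintype.card_fun, Fintype.card_fin, Fintype.card_fin]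
    push_cast
    rw [← Real.rpow_natCast, hs, ← Real.rpow_add two_pos]
    congr 1; ring
  obtain ⟨x, D, hD, -, herr⟩ := exists_decoding_sets hW (sum_memoryless_bsc_right q)
    (sum_memoryless_bsc_left q) (ε := ε) (δ := n * noiseVariance q / t ^ 2) hs0
    (B := fun x => Finset.univ.filter fun y => ¬ memoryless (bsc q) n x y ≤ s)
    (fun x y hy => (not_le.1 (Finset.mem_filter.1 hy).2).le)
    (fun x => by
      have ha := sum_memoryless_atypical_le h0 h1 x ht
      have hb := Finset.sum_filter_add_sum_filter_not Finset.univ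
        (fun y => memoryless (bsc q) n x y ≤ s) (fun y => memoryless (bsc q) n x y)
      rw [sum_memoryless_bsc_right] at hb
      linarith)
    (⌊(2 : ℝ) ^ (n * (1 - binaryEntropy q) - t) * (ε / 2)⌋₊ + 1) (by
      rw [hcard]
      push_cast
      have hp : (0 : ℝ) ≤ (2 : ℝ) ^ (n * (1 - binaryEntropy q) - t) :=
        Real.rpow_nonneg two_pos.le _
      have hfl := Nat.floor_le (mul_nonneg hp (by positivity : (0 : ℝ) ≤ ε / 2))
      have := mul_le_mul_of_nonneg_left (show ε / 2 ≤ ε - n * noiseVariance q / t ^ 2 by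
        linarith) hp
      linarith)
  exact exists_blockCode_of_decoding_sets hW (sum_memoryless_bsc_right q) x D hD herr

open Filter Topology in
theorem tendsto_logb_floor_rate {C c : ℝ} (hC : 0 ≤ C) (hc : 0 < c) :
    Tendsto (fun n : ℕ => Real.logb 2 ((⌊(2 : ℝ) ^ (n * C - (n : ℝ) ^ (3 / 4 : ℝ)) *
      (c * (n : ℝ) ^ (-(1 / 2) : ℝ) / 2)⌋₊ + 1 : ℕ) : ℝ) / n) atTop (𝓝 C) := by
  have hinv : Tendsto (fun n : ℕ => (n : ℝ)⁻¹) atTop (𝓝 0) := tendsto_inv_atTop_nhds_zero_nat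
  have hlog : Tendsto (fun n : ℕ => Real.log n / n) atTop (𝓝 0) :=
    Real.isLittleO_log_id_atTop.tendsto_div_nhds_zero.comp tendsto_natCast_atTop_atTop
  have hpow : Tendsto (fun n : ℕ => (n : ℝ) ^ (-(1 / 4) : ℝ)) atTop (𝓝 0) :=
    (tendsto_rpow_neg_atTop (by norm_num)).comp tendsto_natCast_atTop_atTop
  have hlow : Tendsto (fun n : ℕ => C - (n : ℝ) ^ (-(1 / 4) : ℝ) + Real.logb 2 (c / 2) * (n : ℝ)⁻¹
      - 1 / 2 / Real.log 2 * (Real.log n / n)) atTop (𝓝 C) := by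
    simpa using ((tendsto_const_nhds.sub hpow).add (hinv.const_mul (Real.logb 2 (c / 2)))).sub
      (hlog.const_mul (1 / 2 / Real.log 2))
  have hup : Tendsto (fun n : ℕ => C + Real.logb 2 (c + 1) * (n : ℝ)⁻¹) atTop (𝓝 C) := by
    simpa using tendsto_const_nhds.add (hinv.const_mul (Real.logb 2 (c + 1)))
  refine tendsto_of_tendsto_of_tendsto_of_le_of_le' hlow hup ?_ ?_
  all_goals
    filter_upwards [eventually_ge_atTop 1] with n hn
    have hn1 : (1 : ℝ) ≤ n := by exact_mod_cast hn
    have hn0 : (0 : ℝ) < n := by linarith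
    set E : ℝ := (2 : ℝ) ^ (n * C - (n : ℝ) ^ (3 / 4 : ℝ)) with hE
    have hE0 : 0 < E := Real.rpow_pos_of_pos two_pos _
    set r : ℝ := (n : ℝ) ^ (-(1 / 2) : ℝ) with hr
    have hr0 : 0 < r := Real.rpow_pos_of_pos hn0 _
    have hx0 : 0 < E * (c * r / 2) := by positivity
  · have h1 : E * (c * r / 2) ≤ ((⌊E * (c * r / 2)⌋₊ + 1 : ℕ) : ℝ) := by
      push_cast; exact (Nat.lt_floor_add_one _).le
    have h2 := Real.logb_le_logb_of_le one_lt_two hx0 h1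
    have h3 : Real.logb 2 (E * (c * r / 2))
        = n * C - (n : ℝ) ^ (3 / 4 : ℝ) + Real.logb 2 (c / 2)
          - 1 / 2 / Real.log 2 * Real.log n := by
      rw [show c * r / 2 = c / 2 * r by ring, Real.logb_mul hE0.ne' (by positivity),
        Real.logb_mul (by positivity) hr0.ne', hE, Real.logb_rpow two_pos (by norm_num), hr,
        Real.logb, Real.logb, Real.log_rpow hn0]
      ring
    have h4 : (n : ℝ) ^ (-(1 / 4) : ℝ) * n = (n : ℝ) ^ (3 / 4 : ℝ) := by
      rw [← Real.rpow_add_one hn0.ne']; norm_num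
    rw [le_div_iff₀ hn0]
    refine le_trans (le_of_eq ?_) h2
    rw [h3, ← h4]
    field_simp
  · have hr1 : r ≤ 1 := Real.rpow_le_one_of_one_le_of_nonpos hn1 (by norm_num)
    have hE1 : E ≤ (2 : ℝ) ^ (n * C) := Real.rpow_le_rpow_of_exponent_le one_le_two
      (by linarith [Real.rpow_nonneg hn0.le (3 / 4 : ℝ)])
    have h1 : (1 : ℝ) ≤ (2 : ℝ) ^ (n * C) := Real.one_le_rpow one_le_two (by positivity)
    have h2 : ((⌊E * (c * r / 2)⌋₊ + 1 : ℕ) : ℝ) ≤ (2 : ℝ) ^ (n * C) * (c + 1) := by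
      push_cast
      have h3 := Nat.floor_le hx0.le
      have h4 : E * (c * r / 2) ≤ (2 : ℝ) ^ (n * C) * c :=
        mul_le_mul hE1 (by nlinarith) (by positivity) (by positivity)
      linarith
    have h3 := Real.logb_le_logb_of_le one_lt_two (by positivity) h2
    rw [Real.logb_mul (by positivity) (by positivity), Real.logb_rpow two_pos (by norm_num)] at h3
    rw [div_le_iff₀ hn0]
    refine h3.trans (le_of_eq ?_)
    field_simp

/-- **Shannon's coding theorem** for the binary symmetric channel, with maximal error
probability. -/
theorem exists_achievesRate_bsc {q : ℝ} (h0 : 0 ≤ q) (h1 : q ≤ 1) :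
    ∃ c : (n : ℕ) → BlockCode n,
      AchievesRate (memoryless (bsc q)) c (1 - binaryEntropy q) := by
  have hV := noiseVariance_nonneg h0 h1
  set a : ℝ := 2 * noiseVariance q + 1 with ha
  have key : ∀ n : ℕ, ∃ c : BlockCode n, 1 ≤ n →
      c.size = ⌊(2 : ℝ) ^ (n * (1 - binaryEntropy q) - (n : ℝ) ^ (3 / 4 : ℝ)) *
        (a * (n : ℝ) ^ (-(1 / 2) : ℝ) / 2)⌋₊ + 1 ∧
      ∀ m, errorProb (memoryless (bsc q) n) c m ≤ a * (n : ℝ) ^ (-(1 / 2) : ℝ) := by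
    intro n
    rcases Nat.eq_zero_or_pos n with hn | hn
    · exact ⟨⟨1, fun _ _ => 0, fun _ => 0⟩, fun h => absurd h (by omega)⟩
    · have hn0 : (0 : ℝ) < n := by exact_mod_cast hn
      obtain ⟨c, hc⟩ := exists_blockCode_bsc h0 h1 n (t := (n : ℝ) ^ (3 / 4 : ℝ))
        (ε := a * (n : ℝ) ^ (-(1 / 2) : ℝ)) (Real.rpow_pos_of_pos hn0 _) (by
          have e : (n : ℝ) / ((n : ℝ) ^ (3 / 4 : ℝ)) ^ 2 = (n : ℝ) ^ (-(1 / 2) : ℝ) := by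
            rw [← Real.rpow_natCast, ← Real.rpow_mul hn0.le]
            nth_rewrite 1 [← Real.rpow_one (n : ℝ)]
            rw [← Real.rpow_sub hn0]; norm_num
          rw [mul_div_right_comm, e, ha]
          nlinarith [Real.rpow_nonneg hn0.le (-(1 / 2) : ℝ)])
      exact ⟨c, fun _ => hc⟩
  choose c hc using key
  have he : Filter.Tendsto (fun n : ℕ => a * (n : ℝ) ^ (-(1 / 2) : ℝ)) Filter.atTop (nhds 0) := by
    simpa using ((tendsto_rpow_neg_atTop (by norm_num : (0 : ℝ) < 1 / 2)).comp
      tendsto_natCast_atTop_atTop).const_mul a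
  refine ⟨c, ?_, ?_⟩
  · refine (tendsto_logb_floor_rate (sub_nonneg.2 (binaryEntropy_le_one q))
      (by positivity : 0 < a)).congr' ?_
    filter_upwards [Filter.eventually_ge_atTop 1] with n hn
    rw [(hc n hn).1]
  · refine tendsto_of_tendsto_of_tendsto_of_le_of_le' tendsto_const_nhds he
      (Filter.Eventually.of_forall fun n => Real.iSup_nonneg fun m => ?_) ?_
    · refine Finset.sum_nonneg fun y _ => ?_
      split_ifs
      · exact le_rfl
      · exact memoryless_nonneg (bsc_nonneg h0 h1) _ _
    · filter_upwards [Filter.eventually_ge_atTop 1] with n hn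
      exact Real.iSup_le (hc n hn).2
        (mul_nonneg (by positivity) (Real.rpow_nonneg (Nat.cast_nonneg n) _))

end UnitalQubit

theorem mainTheorem1 (Φ : UnitalQubit.Op →ₗ[ℂ] UnitalQubit.Op)
    (hΦ : UnitalQubit.IsUnitalQubitChannel Φ) :
    -- the suprema defining `M_Φ` and `χ(Φ)` are finite, and `M_Φ` is a valid flip probability
    BddAbove (UnitalQubit.outputNorms Φ) ∧
    BddAbove (UnitalQubit.holevoValues Φ) ∧
    UnitalQubit.maxOutputNorm Φ ∈ Set.Icc (1 / 2 : ℝ) 1 ∧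
    -- the scheme can be carried out, with a projective measurement
    (UnitalQubit.normMaximizers Φ).Nonempty ∧
    (∀ ρ ∈ UnitalQubit.normMaximizers Φ, ∃ τ ∈ UnitalQubit.detectors Φ ρ, IsStarProjection τ) ∧
    -- every choice of `ρ*` and `τ*` works
    ∀ ρ ∈ UnitalQubit.normMaximizers Φ, ∀ τ ∈ UnitalQubit.detectors Φ ρ,
      (∀ x, UnitalQubit.IsState (UnitalQubit.encoder ρ x)) ∧
      UnitalQubit.IsPOVM (UnitalQubit.measurement τ) ∧
      (UnitalQubit.maxOutputNorm Φ ≠ 1 / 2 →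
        ∀ y, IsStarProjection (UnitalQubit.measurement τ y)) ∧
      -- the induced classical channel is a memoryless binary symmetric channel
      UnitalQubit.inducedChannel Φ (UnitalQubit.encoder ρ) (UnitalQubit.measurement τ)
        = UnitalQubit.bsc (UnitalQubit.maxOutputNorm Φ) ∧
      (∀ n, UnitalQubit.inducedBlockChannel Φ (UnitalQubit.encoder ρ) (UnitalQubit.measurement τ) n
        = UnitalQubit.memoryless (UnitalQubit.bsc (UnitalQubit.maxOutputNorm Φ)) n) ∧
      -- its Shannon capacity is a maximum, and equals `1 - h(M_Φ) = χ(Φ)`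
      UnitalQubit.shannonCapacity
          (UnitalQubit.inducedChannel Φ (UnitalQubit.encoder ρ) (UnitalQubit.measurement τ))
        ∈ UnitalQubit.mutualInformations
          (UnitalQubit.inducedChannel Φ (UnitalQubit.encoder ρ) (UnitalQubit.measurement τ)) ∧
      BddAbove (UnitalQubit.mutualInformations
        (UnitalQubit.inducedChannel Φ (UnitalQubit.encoder ρ) (UnitalQubit.measurement τ))) ∧
      UnitalQubit.shannonCapacity
          (UnitalQubit.inducedChannel Φ (UnitalQubit.encoder ρ) (UnitalQubit.measurement τ))
        = 1 - UnitalQubit.binaryEntropy (UnitalQubit.maxOutputNorm Φ) ∧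
      1 - UnitalQubit.binaryEntropy (UnitalQubit.maxOutputNorm Φ)
        = UnitalQubit.holevoInformation Φ ∧
      -- capacity-achieving codes for the binary symmetric channel exist, and any such sequence of
      -- codes, used with the scheme over `n` independent uses of `Φ`, achieves `χ(Φ)`
      (∃ c : (n : ℕ) → UnitalQubit.BlockCode n,
        UnitalQubit.AchievesRate
          (UnitalQubit.memoryless (UnitalQubit.bsc (UnitalQubit.maxOutputNorm Φ))) c
          (UnitalQubit.shannonCapacity (UnitalQubit.bsc (UnitalQubit.maxOutputNorm Φ)))) ∧
      ∀ c : (n : ℕ) → UnitalQubit.BlockCode n,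
        UnitalQubit.AchievesRate
          (UnitalQubit.memoryless (UnitalQubit.bsc (UnitalQubit.maxOutputNorm Φ))) c
          (UnitalQubit.shannonCapacity (UnitalQubit.bsc (UnitalQubit.maxOutputNorm Φ))) →
        UnitalQubit.AchievesRate
          (UnitalQubit.inducedBlockChannel Φ (UnitalQubit.encoder ρ) (UnitalQubit.measurement τ)) c
          (UnitalQubit.holevoInformation Φ) := by
  obtain ⟨h2, h1⟩ := hΦ.maxOutputNorm_mem
  have h0 : 0 ≤ UnitalQubit.maxOutputNorm Φ := by linarith
  have hχ := hΦ.isGreatest_holevoValues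
  refine ⟨hΦ.bddAbove_outputNorms, ⟨_, hχ.2⟩, ⟨h2, h1⟩,
    UnitalQubit.normMaximizers_nonempty hΦ,
    fun ρ hρ => UnitalQubit.exists_projection_mem_detectors hΦ hρ, fun ρ hρ τ hτ => ?_⟩
  have hI := UnitalQubit.isGreatest_mutualInformations_bsc (UnitalQubit.maxOutputNorm Φ)
  have hC := UnitalQubit.shannonCapacity_bsc (UnitalQubit.maxOutputNorm Φ)
  have hind := UnitalQubit.inducedChannel_eq_bsc hΦ hρ hτ
  have hblock := UnitalQubit.inducedBlockChannel_eq_memoryless hΦ hρ hτ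
  refine ⟨UnitalQubit.isState_encoder hρ.1, UnitalQubit.isPOVM_measurement hτ.1,
    UnitalQubit.isStarProjection_measurement hΦ hρ hτ, hind, hblock, ?_, ?_, ?_, hχ.csSup_eq.symm,
    ?_, fun c hc => ?_⟩
  · rw [hind, hC]; exact hI.1
  · rw [hind]; exact ⟨_, hI.2⟩
  · rw [hind, hC]
  · rw [hC]; exact UnitalQubit.exists_achievesRate_bsc h0 h1
  · rw [funext hblock]
    rwa [hC, ← hχ.csSup_eq] at hc
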